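/- Let $G$ be a finite simple graph. A set $S\subseteq V(G)$ is a dissociation set of $G$ if every vertex of the induced subgraph $G[S]$ has degree at most one; $d(G)$ denotes the number of dissociation sets of $G$ (including the empty set). For a graph $H=K_{s_1}\cup\dots\cup K_{s_t}$ that is a disjoint union of complete graphs, $K_r*H$ denotes the graph obtained from the disjoint union of $K_r$ and $H$ by choosing one vertex $u$ of $K_r$ and joining $u$ to exactly one vertex of each component of $H$. For $n\ge 9$ let $$h(n)=\begin{cases}2^{n-1}+(n+9)\,2^{\frac{n-7}{2}}&\text{if } n \text{ is odd},\\ 2^{n-1}+(n+12)\,2^{\frac{n-8}{2}}&\text{if } n\text{ is even},\end{cases}$$ $$F_n=\begin{cases}K_1*\frac{n-1}{2}K_2&\text{if } n\text{ is odd},\\ K_2*\frac{n-2}{2}K_2&\text{if } n\text{ is even},\end{cases}\qquad T_n=\begin{cases}K_1*\left(2K_1\cup\frac{n-3}{2}K_2\right)&\text{if } n\text{ is odd},\\ K_1*\left(3K_1\cup\frac{n-4}{2}K_2\right)&\text{if } n\text{ is even}.\end{cases}$$ **Theorem.** Let $n\ge 9$ and let $T$ be a tree of order $n$ with $T\not\cong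 F_n$. Then $d(T)\le h(n)$, and equality holds if and only if $T\cong T_n$. -/

import Mathlib

/-- A vertex set `S` is a dissociation set of `G` if the subgraph induced by `S` has all vertex
degrees at most one. -/
def IsDissociationSet {V : Type*} (G : SimpleGraph V) (S : Set V) : Prop :=
  ∀ v : S, ((G.induce S).neighborSet v).encard ≤ 1

/-- The set of all dissociation sets of `G`. -/
def dissociationSets {V : Type*} (G : SimpleGraph V) : Set (Set V) :=
  {S | IsDissociationSet G S}

/-- `d(G)`: the number of dissociation sets of the (finite) graph `G`. -/
noncomputable def numDissociationSets {V : Type*} (G : SimpleGraph V) : ℕ :=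
  (dissociationSets G).ncard

/-- Adjacency of `K_r * (⋃ᵢ K_{s i})`: the vertices of `K_r`, and those of each `K_{s i}`, are pairwise adjacent, and
vertex `0` of `K_r` is joined to vertex `0` of each component `K_{s i}`. -/
def starAdj (r : ℕ) {ι : Type*} (s : ι → ℕ) :
    Fin r ⊕ (Σ i, Fin (s i)) → Fin r ⊕ (Σ i, Fin (s i)) → Prop
  | .inl a, .inl b => a ≠ b
  | .inl a, .inr y => a.val = 0 ∧ y.2.val = 0
  | .inr x, .inl b => b.val = 0 ∧ x.2.val = 0
  | .inr x, .inr y => x ≠ y ∧ x.1 = y.1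

/-- The graph `K_r * (⋃ᵢ K_{s i})`: the disjoint union of `K_r` and the complete graphs `K_{s i}`,
where one fixed vertex of `K_r` is joined to exactly one vertex of each `K_{s i}`. -/
def starGraphOf (r : ℕ) {ι : Type*} (s : ι → ℕ) : SimpleGraph (Fin r ⊕ (Σ i, Fin (s i))) where
  Adj := starAdj r s
  symm := ⟨by
    rintro (a | x) (b | y) h
    · exact Ne.symm h
    · exact h
    · exact h
    · exact ⟨Ne.symm h.1, h.2.symm⟩⟩
  loopless := ⟨by
    rintro (a | x) h
    · exact h rfl
    · exact h.1 rfl⟩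

/-- Sizes of the components of `a K_1 ∪ b K_2`. -/
def blockSizes (a b : ℕ) : Fin a ⊕ Fin b → ℕ :=
  Sum.elim (fun _ => 1) (fun _ => 2)

/-- The graph `K_r * (a K_1 ∪ b K_2)`. -/
def starK (r a b : ℕ) : SimpleGraph (Fin r ⊕ (Σ i, Fin (blockSizes a b i))) :=
  starGraphOf r (blockSizes a b)

/-- `G ≅ F_n`: here `F_n` is `K_1 * ((n-1)/2) K_2` for odd `n`, `K_2 * ((n-2)/2) K_2` for
even `n ≠ 6`, and either of `P_6`, `K_2 * 2 K_2` for `n = 6`. -/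
def IsoF {V : Type*} (n : ℕ) (G : SimpleGraph V) : Prop :=
  if Odd n then Nonempty (G ≃g starK 1 0 ((n - 1) / 2))
  else if n = 6 then
    Nonempty (G ≃g SimpleGraph.pathGraph 6) ∨ Nonempty (G ≃g starK 2 0 2)
  else Nonempty (G ≃g starK 2 0 ((n - 2) / 2))

/-- `G ≅ T_n`: here `T_n` is `K_1 * (2 K_1 ∪ ((n-3)/2) K_2)` for odd `n` and
`K_1 * (3 K_1 ∪ ((n-4)/2) K_2)` for even `n`. -/
def IsoT {V : Type*} (n : ℕ) (G : SimpleGraph V) : Prop :=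
  if Odd n then Nonempty (G ≃g starK 1 2 ((n - 3) / 2))
  else Nonempty (G ≃g starK 1 3 ((n - 4) / 2))

/-- The bound `h(n)`. For `n ≥ 7` all subtractions and divisions below are exact. -/
def hBound (n : ℕ) : ℕ :=
  if Odd n then 2 ^ (n - 1) + (n + 9) * 2 ^ ((n - 7) / 2)
  else if n = 6 then 42
  else 2 ^ (n - 1) + (n + 12) * 2 ^ ((n - 8) / 2)

/-!
Call a tree a *spider* if it has a vertex `u` such that all components of `T - u` have at most two
vertices. The proof compares the spiders, for which the number of dissociation sets is computed
exactly, with all other trees, for which it is too small.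

A spider of order `n = 1 + a + 2 * b` with `a` legs of length one and `b` legs of length two
satisfies `2 * d = 2 ^ n + 2 ^ b * (2 + 2 * a + b)`: all sets that avoid the centre are dissociation
sets, and one that contains it contains at most one of its neighbours
(`two_mul_numDissociationSets_legSpider`). For fixed `n` the parity of `a` is fixed, and the number
decreases strictly as `a` grows. The two smallest values of `a` belong to `F_n` and to `T_n`.

For the other trees, the basic remark is that a subgraph `H` of `T` with `k` vertices yields
`d(T) ≤ d(H) * 2 ^ (n - k)`. A tree that is not a spider contains one of three trees of order `6`
that are not spiders: the path, the double star with two leaves at each of two adjacent vertices,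
and the tree with legs of length `1, 1, 3` at a vertex of degree three
(`exists_isSpiderCentre_or_hasSubtree`). By connectedness, this subtree of `T` can be enlarged by one
leaf at a time until it contains all vertices. Exploring all ways to do so, one finds
that after at most five steps, at most half of the vertex sets of the subtree are dissociation sets,
so that `d(T) ≤ 2 ^ (n - 1) < h(n)`, unless `T` itself has order `9` or `10` and is exhausted
earlier, in which case `d(T) < h(n)` as well. This exploration is the Boolean function `growthSearch`,
evaluated by the kernel. It bounds `d` of a tree by removing leaves one at a time, each leaf passing
on three weights to its neighbour (`weightedCount_insert_le`).
-/

open Finset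

/-! ### Dissociation sets within a vertex set -/

/-- `S` contains no vertex with two distinct neighbours in `S`: the finset form of
`IsDissociationSet`. -/
def Dissociated {V : Type*} (G : SimpleGraph V) (S : Finset V) : Prop :=
  ∀ v ∈ S, ∀ a ∈ S, ∀ b ∈ S, G.Adj v a → G.Adj v b → a = b

open Classical in
/-- The number of dissociation sets of `G` contained in `X`. -/
noncomputable def dissociatedCount {V : Type*} (G : SimpleGraph V) (X : Finset V) : ℕ :=
  #{S ∈ X.powerset | Dissociated G S}

theorem Dissociated.mono {V : Type*} {G : SimpleGraph V} {S S' : Finset V}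
    (h : Dissociated G S) (hS : S' ⊆ S) : Dissociated G S' :=
  fun v hv a ha b hb => h v (hS hv) a (hS ha) b (hS hb)

theorem isDissociationSet_coe_iff {V : Type*} (G : SimpleGraph V) (S : Finset V) :
    IsDissociationSet G (S : Set V) ↔ Dissociated G S := by
  unfold IsDissociationSet Dissociated
  constructor
  · intro h v hv a ha b hb hva hvb
    have := Set.encard_le_one_iff.1 (h ⟨v, hv⟩) ⟨a, ha⟩ ⟨b, hb⟩ (by simpa using hva)
      (by simpa using hvb)
    simpa using this
  · rintro h ⟨v, hv⟩
    rw [Set.encard_le_one_iff]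
    rintro ⟨a, ha⟩ ⟨b, hb⟩ hva hvb
    have := h v hv a ha b hb (by simpa using hva) (by simpa using hvb)
    simpa using this

theorem numDissociationSets_eq {V : Type*} [Fintype V] (G : SimpleGraph V) :
    numDissociationSets G = dissociatedCount G univ := by
  classical
  have h : dissociationSets G =
      (fun S : Finset V => (S : Set V)) '' ({S ∈ (univ : Finset V).powerset | Dissociated G S} :
        Finset (Finset V)) := by
    ext S
    simp only [dissociationSets, Set.mem_ofPred_eq, Set.mem_image, coe_filter, mem_powerset,
      subset_univ, true_and]
    constructor
    · intro hS
      refine ⟨S.toFinite.toFinset, ?_, by simp⟩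
      rw [← isDissociationSet_coe_iff]
      simpa using hS
    · rintro ⟨S', hS', rfl⟩
      exact (isDissociationSet_coe_iff G S').2 hS'
  rw [numDissociationSets, h, Set.ncard_image_of_injective _ Finset.coe_injective,
    Set.ncard_coe_finset, dissociatedCount]

theorem numDissociationSets_congr {V W : Type*} [Fintype V] [Fintype W] {G : SimpleGraph V}
    {H : SimpleGraph W} (e : G ≃g H) : numDissociationSets G = numDissociationSets H := by
  classical
  rw [numDissociationSets_eq, numDissociationSets_eq]
  unfold dissociatedCount
  refine Finset.card_bij (fun S _ => S.map e.toEquiv.toEmbedding) ?_ ?_ ?_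
  · intro S hS
    simp only [mem_filter, mem_powerset, subset_univ, true_and] at hS ⊢
    intro v hv a ha b hb hva hvb
    simp only [mem_map_equiv] at hv ha hb
    have := hS _ hv _ ha _ hb (e.symm.map_adj_iff.2 hva) (e.symm.map_adj_iff.2 hvb)
    exact e.symm.injective this
  · intro S _ S' _ h
    exact Finset.map_injective _ h
  · intro S hS
    simp only [mem_filter, mem_powerset, subset_univ, true_and] at hS
    refine ⟨S.map e.symm.toEquiv.toEmbedding, ?_, ?_⟩
    · simp only [mem_filter, mem_powerset, subset_univ, true_and]
      intro v hv a ha b hb hva hvb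
      simp only [mem_map_equiv] at hv ha hb
      have := hS _ hv _ ha _ hb (e.map_adj_iff.2 hva) (e.map_adj_iff.2 hvb)
      exact e.injective this
    · ext x
      simp only [mem_map_equiv]
      change e (e.symm x) ∈ S ↔ _
      simp

/-- Each deleted vertex at most halves the number of dissociation sets. -/
theorem dissociatedCount_le_of_subset {V : Type*} (G : SimpleGraph V) {X Y : Finset V}
    (h : X ⊆ Y) : dissociatedCount G Y ≤ dissociatedCount G X * 2 ^ (#Y - #X) := by
  classical
  rw [← card_sdiff_of_subset h, ← card_powerset, dissociatedCount, dissociatedCount,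
    ← card_product]
  refine card_le_card_of_injOn (fun S => (S ∩ X, S \ X)) ?_ ?_
  · intro S hS
    simp only [coe_filter, mem_powerset, Set.mem_ofPred_eq, coe_product, Set.mem_prod] at hS ⊢
    refine ⟨⟨inter_subset_right, hS.2.mono inter_subset_left⟩, ?_⟩
    exact mem_coe.2 (mem_powerset.2 (sdiff_subset_sdiff hS.1 (subset_refl X)))
  · intro S _ S' _ h
    simp only [Prod.mk.injEq] at h
    rw [← sdiff_union_inter S X, ← sdiff_union_inter S' X, h.1, h.2]

theorem dissociatedCount_image_le {V : Type*} [DecidableEq V] (G : SimpleGraph V) {φ : ℕ → V}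
    {X : Finset ℕ} (hφ : Set.InjOn φ X) :
    dissociatedCount G (X.image φ) ≤ dissociatedCount (G.comap φ) X := by
  classical
  refine card_le_card_of_injOn (fun S => {i ∈ X | φ i ∈ S}) ?_ ?_
  · intro S hS
    simp only [coe_filter, mem_powerset, Set.mem_ofPred_eq] at hS ⊢
    refine ⟨filter_subset _ _, ?_⟩
    intro v hv a ha b hb hva hvb
    simp only [mem_filter] at hv ha hb
    exact hφ ha.1 hb.1 (hS.2 _ hv.2 _ ha.2 _ hb.2 hva hvb)
  · intro S hS S' hS' h
    simp only [coe_filter, mem_powerset, Set.mem_ofPred_eq] at hS hS'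
    have key : ∀ S, S ⊆ X.image φ → S = image φ {i ∈ X | φ i ∈ S} := by
      intro S hS
      ext x
      simp only [mem_image, mem_filter]
      constructor
      · intro hx
        obtain ⟨i, hi, rfl⟩ := mem_image.1 (hS hx)
        exact ⟨i, ⟨hi, hx⟩, rfl⟩
      · rintro ⟨i, hi, rfl⟩
        exact hi.2
    rw [key S hS.1, key S' hS'.1]
    exact congrArg _ h

/-! ### Weights and the removal of a leaf -/

open Classical in
/-- The factor contributed by the vertex `v` to the weight of `S`: `A v` if `v ∉ S`, and for
`v ∈ S` the value `B v`, plus `C v` if `v` has no neighbour in `S`.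

Here `A v`, `B v`, `C v` count the ways to extend `S` to a tree hanging at `v`, given
that `v` is not chosen, that `v` is chosen and has no chosen neighbour in that tree, and that `v`
is chosen and has a chosen neighbour there. -/
noncomputable def vertexWeight (G : SimpleGraph ℕ) (A B C : ℕ → ℕ) (S : Finset ℕ) (v : ℕ) : ℕ :=
  if v ∉ S then A v else if ∃ u ∈ S, G.Adj v u then B v else B v + C v

open Classical in
/-- The weighted number of dissociation sets contained in `X`. -/
noncomputable def weightedCount (G : SimpleGraph ℕ) (X : Finset ℕ) (A B C : ℕ → ℕ) : ℕ :=
  ∑ S ∈ X.powerset with Dissociated G S, ∏ v ∈ X, vertexWeight G A B C S v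

theorem weightedCount_one (G : SimpleGraph ℕ) (X : Finset ℕ) :
    weightedCount G X (fun _ => 1) (fun _ => 1) (fun _ => 0) = dissociatedCount G X := by
  simp [weightedCount, vertexWeight, dissociatedCount]

theorem vertexWeight_insert_le (G : SimpleGraph ℕ) (A B C : ℕ → ℕ) (S : Finset ℕ) {v l : ℕ}
    (h : v ≠ l) : vertexWeight G A B C (insert l S) v ≤ vertexWeight G A B C S v := by
  unfold vertexWeight
  by_cases hv : v ∈ S
  · have hv' : ¬ v ∉ S := not_not.2 hv
    have hvl : ¬ v ∉ insert l S := not_not.2 (mem_insert_of_mem hv)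
    by_cases h1 : ∃ u ∈ S, G.Adj v u
    · have : ∃ u ∈ insert l S, G.Adj v u := by
        obtain ⟨u, hu, huv⟩ := h1
        exact ⟨u, mem_insert_of_mem hu, huv⟩
      rw [if_neg hvl, if_neg hv', if_pos this, if_pos h1]
    · rw [if_neg hvl, if_neg hv', if_neg h1]
      split_ifs <;> omega
  · rw [if_pos (by simp [hv, h]), if_pos (by simp [hv])]

/-- Removing a vertex `l` joined to `p` and transferring its weights to `p`. Further
edges at `l` only decrease the left-hand side. -/
theorem weightedCount_insert_le (G : SimpleGraph ℕ) {X : Finset ℕ} {l p : ℕ} (hl : l ∉ X)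
    (hp : p ∈ X) (hlp : G.Adj l p) (A B C : ℕ → ℕ) :
    weightedCount G (insert l X) A B C ≤
      weightedCount G X (Function.update A p (A p * (A l + B l + C l)))
        (Function.update B p (B p * A l)) (Function.update C p (C p * A l + B p * B l)) := by
  classical
  unfold weightedCount
  rw [sum_filter, sum_filter, sum_powerset_insert hl, ← sum_add_distrib]
  refine sum_le_sum fun S hS => ?_
  rw [mem_powerset] at hS
  have hlS : l ∉ S := fun h => hl (hS h)
  have hpl : p ≠ l := fun h => hl (h ▸ hp)
  set A' := Function.update A p (A p * (A l + B l + C l))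
  set B' := Function.update B p (B p * A l)
  set C' := Function.update C p (C p * A l + B p * B l)
  have hrest : ∀ v ∈ X.erase p, vertexWeight G A' B' C' S v = vertexWeight G A B C S v := by
    intro v hv
    have hvp : v ≠ p := ne_of_mem_erase hv
    simp [vertexWeight, A', B', C', hvp]
  rw [prod_insert hl, prod_insert hl, ← mul_prod_erase X _ hp, ← mul_prod_erase X _ hp,
    ← mul_prod_erase X _ hp, prod_congr rfl hrest]
  set P := ∏ v ∈ X.erase p, vertexWeight G A B C S v
  have hP : ∏ v ∈ X.erase p, vertexWeight G A B C (insert l S) v ≤ P := by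
    refine prod_le_prod' fun v hv => vertexWeight_insert_le G A B C S ?_
    rintro rfl
    exact hl (mem_of_mem_erase hv)
  set P' := ∏ v ∈ X.erase p, vertexWeight G A B C (insert l S) v
  have hwl : vertexWeight G A B C S l = A l := by simp [vertexWeight, hlS]
  have hwl' : vertexWeight G A B C (insert l S) l ≤ B l + C l := by
    unfold vertexWeight
    rw [if_neg (by simp)]
    split_ifs <;> omega
  by_cases hd : Dissociated G S
  swap
  · have hd' : ¬ Dissociated G (insert l S) := fun h => hd (h.mono (subset_insert _ _))
    simp [hd, hd']
  rw [if_pos hd, if_pos hd, hwl]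
  by_cases hpS : p ∈ S
  swap
  · have h1 : vertexWeight G A B C S p = A p := by simp [vertexWeight, hpS]
    have h2 : vertexWeight G A B C (insert l S) p = A p := by simp [vertexWeight, hpS, hpl]
    have h3 : vertexWeight G A' B' C' S p = A p * (A l + B l + C l) := by
      simp [vertexWeight, hpS, A']
    rw [h1, h2, h3]
    have h4 : (if Dissociated G (insert l S) then
        vertexWeight G A B C (insert l S) l * (A p * P') else 0) ≤ (B l + C l) * (A p * P) := by
      split_ifs
      · gcongr
      · exact Nat.zero_le _
    calc _ ≤ A l * (A p * P) + (B l + C l) * (A p * P) := by gcongr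
      _ = _ := by ring
  · by_cases hiso : ∃ u ∈ S, G.Adj p u
    · have hd' : ¬ Dissociated G (insert l S) := by
        intro h
        obtain ⟨u, hu, hpu⟩ := hiso
        have := h p (by simp [hpS]) l (by simp) u (by simp [hu]) hlp.symm hpu
        exact hlS (this ▸ hu)
      have h1 : vertexWeight G A B C S p = B p := by
        rw [vertexWeight, if_neg (by simp [hpS]), if_pos hiso]
      have h3 : vertexWeight G A' B' C' S p = B p * A l := by
        rw [vertexWeight, if_neg (by simp [hpS]), if_pos hiso]
        simp [B']
      rw [if_neg hd', h1, h3]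
      exact le_of_eq (by ring)
    · have h1 : vertexWeight G A B C S p = B p + C p := by
        rw [vertexWeight, if_neg (by simp [hpS]), if_neg hiso]
      have h3 : vertexWeight G A' B' C' S p = B p * A l + (C p * A l + B p * B l) := by
        rw [vertexWeight, if_neg (by simp [hpS]), if_neg hiso]
        simp [B', C']
      have h5 : vertexWeight G A B C (insert l S) l = B l := by
        rw [vertexWeight, if_neg (by simp), if_pos ⟨p, by simp [hpS], hlp⟩]
      have h6 : vertexWeight G A B C (insert l S) p = B p := by
        rw [vertexWeight, if_neg (by simp [hpS]), if_pos ⟨l, by simp, hlp.symm⟩]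
      have h4 : (if Dissociated G (insert l S) then
          vertexWeight G A B C (insert l S) l * (vertexWeight G A B C (insert l S) p * P')
          else 0) ≤ B l * (B p * P) := by
        rw [h5, h6]
        split_ifs
        · gcongr
        · exact Nat.zero_le _
      rw [h1, h3]
      calc _ ≤ A l * ((B p + C p) * P) + B l * (B p * P) := by gcongr
        _ = _ := by ring

/-! ### Growing a subtree leaf by leaf -/

/-- The weighted number of dissociation sets of the tree on `0, …, t.length` in which the `k`-th
entry of `t`, counted from the end and starting with `1`, is the parent of the vertex `k`. The
vertices are removed in decreasing order, each one transferring its weights to its parent. -/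
def leafEval : List ℕ → (ℕ → ℕ) → (ℕ → ℕ) → (ℕ → ℕ) → ℕ
  | [], A, B, C => A 0 + B 0 + C 0
  | p :: t, A, B, C =>
    leafEval t
      (Function.update A p (A p * (A (t.length + 1) + B (t.length + 1) + C (t.length + 1))))
      (Function.update B p (B p * A (t.length + 1)))
      (Function.update C p (C p * A (t.length + 1) + B p * B (t.length + 1)))

/-- The number of dissociation sets of the tree with parent list `t`. -/
def treeCount (t : List ℕ) : ℕ :=
  leafEval t (fun _ => 1) (fun _ => 1) (fun _ => 0)

/-- Every edge of the tree with parent list `t` is an edge of `G`. -/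
def ContainsTree (G : SimpleGraph ℕ) : List ℕ → Prop
  | [] => True
  | p :: t => p ≤ t.length ∧ G.Adj (t.length + 1) p ∧ ContainsTree G t

theorem ContainsTree.congr {G H : SimpleGraph ℕ} : ∀ {t : List ℕ}, ContainsTree G t →
    (∀ i ≤ t.length, ∀ j ≤ t.length, G.Adj i j → H.Adj i j) → ContainsTree H t
  | [], _, _ => trivial
  | p :: t, ⟨hp, hadj, ht⟩, h => by
    simp only [List.length_cons] at h
    exact ⟨hp, h _ le_rfl _ (by omega) hadj,
      ht.congr fun i hi j hj => h i (by omega) j (by omega)⟩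

theorem weightedCount_le_leafEval {G : SimpleGraph ℕ} : ∀ (t : List ℕ) (A B C : ℕ → ℕ),
    ContainsTree G t → weightedCount G (range (t.length + 1)) A B C ≤ leafEval t A B C
  | [], A, B, C, _ => by
    classical
    have h0 : Dissociated G ∅ := by simp [Dissociated]
    have h1 : Dissociated G {0} := by simp [Dissociated]
    have hp : (({0} : Finset ℕ).powerset : Finset (Finset ℕ)) = {∅, {0}} := by decide
    simp [weightedCount, leafEval, hp, sum_filter, h0, h1, vertexWeight, add_assoc]
  | p :: t, A, B, C, ⟨hp, hadj, ht⟩ => by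
    rw [List.length_cons, range_add_one]
    exact (weightedCount_insert_le G (by simp) (by simp; omega) hadj A B C).trans
      (weightedCount_le_leafEval t _ _ _ ht)

theorem numDissociationSets_le_treeCount {V : Type*} [Fintype V] {T : SimpleGraph V}
    {t : List ℕ} {φ : ℕ → V} (hφ : Set.InjOn φ (range (t.length + 1)))
    (ht : ContainsTree (T.comap φ) t) :
    numDissociationSets T ≤ treeCount t * 2 ^ (Fintype.card V - (t.length + 1)) := by
  classical
  rw [numDissociationSets_eq]
  refine (dissociatedCount_le_of_subset T (subset_univ ((range (t.length + 1)).image φ))).trans ?_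
  rw [card_image_of_injOn hφ, card_range, card_univ]
  gcongr
  refine (dissociatedCount_image_le T hφ).trans ?_
  rw [← weightedCount_one]
  exact weightedCount_le_leafEval t _ _ _ ht

/-- The value of `hBound` for `n = 9` and `n = 10`. For larger `n`, where the search never needs
it, the value `556` is still at most `hBound n`. -/
def orderCap (n : ℕ) : ℕ :=
  if n = 9 then 292 else 556

/-- Exhaustive search through the trees that arise from the tree with parent list `t` by adding
leaves, the parents of the new vertices forming a weakly increasing sequence with terms at
least `i`. A branch ends at a tree for which at most half of all vertex sets are dissociation sets.
The result is `true` if all branches end within the given number of steps, and the trees of order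
at least `9` before their ends have fewer than `orderCap` dissociation sets. -/
def growthSearch : ℕ → List ℕ → ℕ → Bool
  | 0, _, _ => false
  | fuel + 1, t, i =>
    (treeCount t).ble (2 ^ t.length) ||
      (((t.length + 1).blt 9 || (treeCount t).blt (orderCap (t.length + 1))) &&
        (List.range' i (t.length + 1 - i)).all fun j => growthSearch fuel (j :: t) j)

theorem growthSearch_path : growthSearch 6 [4, 3, 2, 1, 0] 0 = true := by decide +kernel

theorem growthSearch_doubleStar : growthSearch 6 [1, 1, 0, 0, 0] 0 = true := by decide +kernel

theorem growthSearch_fork : growthSearch 6 [4, 3, 0, 0, 0] 0 = true := by decide +kernel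

/-- A tree subgraph of a connected graph that does not contain all vertices can be extended by a
leaf. Choosing its parent `j` with the least possible label, the neighbours of the vertices with
smaller labels already lie in the subgraph. This is why the search only has to consider weakly
increasing sequences of parents. -/
theorem exists_extension {V : Type*} [Fintype V] {T : SimpleGraph V} (hT : T.Connected)
    {k : ℕ} (hk : 0 < k) {φ : ℕ → V} (hlt : k < Fintype.card V) {i : ℕ}
    (hi : ∀ j < i, j < k → ∀ v, T.Adj (φ j) v → ∃ m < k, φ m = v) :
    ∃ j v, i ≤ j ∧ j < k ∧ T.Adj (φ j) v ∧ (∀ m < k, φ m ≠ v) ∧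
      ∀ j' < j, ∀ v, T.Adj (φ j') v → ∃ m < k, φ m = v := by
  classical
  have hex : ∃ j, j < k ∧ ∃ v, T.Adj (φ j) v ∧ ∀ m < k, φ m ≠ v := by
    obtain ⟨w, hw⟩ : ∃ w, w ∉ (range k).image φ := by
      by_contra! h
      have h1 : #((range k).image φ) ≤ k := card_image_le.trans (card_range k).le
      rw [eq_univ_iff_forall.2 h, card_univ] at h1
      omega
    obtain ⟨p⟩ := hT.preconnected (φ 0) w
    obtain ⟨d, -, hd1, hd2⟩ := p.exists_boundary_dart {x | ∃ m < k, φ m = x} ⟨0, hk, rfl⟩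
      (by simpa using hw)
    obtain ⟨j, hj, hjd⟩ := hd1
    refine ⟨j, hj, d.snd, hjd ▸ d.adj, fun m hm hmd => hd2 ⟨m, hm, hmd⟩⟩
  obtain ⟨hjk, v, hv, hvm⟩ := Nat.find_spec hex
  refine ⟨Nat.find hex, v, ?_, hjk, hv, hvm, ?_⟩
  · by_contra! h
    obtain ⟨m, hm, hmv⟩ := hi _ h hjk v hv
    exact hvm m hm hmv
  · intro j' hj' v' hv'
    have := Nat.find_min hex hj'
    push Not at this
    exact this (by omega) v' hv'

theorem numDissociationSets_of_growthSearch {V : Type*} [Fintype V] {T : SimpleGraph V}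
    (hT : T.Connected) (hV : 9 ≤ Fintype.card V) : ∀ (fuel : ℕ) (t : List ℕ) (i : ℕ) (φ : ℕ → V),
    growthSearch fuel t i = true → Set.InjOn φ (range (t.length + 1)) →
    ContainsTree (T.comap φ) t →
    (∀ j < i, j < t.length + 1 → ∀ v, T.Adj (φ j) v → ∃ m < t.length + 1, φ m = v) →
    numDissociationSets T ≤ 2 ^ (Fintype.card V - 1) ∨
      numDissociationSets T < orderCap (Fintype.card V) := by
  classical
  intro fuel
  induction fuel with
  | zero =>
    intro t i φ h
    simp [growthSearch] at h
  | succ fuel ih =>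
    intro t i φ h hφ ht hi
    have hle : t.length + 1 ≤ Fintype.card V := by
      have := card_le_univ ((range (t.length + 1)).image φ)
      rwa [card_image_of_injOn hφ, card_range] at this
    have hcount := numDissociationSets_le_treeCount hφ ht
    rw [growthSearch, Bool.or_eq_true, Bool.and_eq_true, Bool.or_eq_true, List.all_eq_true,
      Nat.ble_eq, Nat.blt_eq, Nat.blt_eq] at h
    rcases h with h | ⟨hcap, hall⟩
    · left
      calc _ ≤ _ := hcount
        _ ≤ 2 ^ t.length * 2 ^ (Fintype.card V - (t.length + 1)) := by gcongr
        _ = 2 ^ (Fintype.card V - 1) := by rw [← pow_add]; congr 1; omega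
    · rcases hle.eq_or_lt with heq | hlt
      · right
        rw [← heq] at hV hcount ⊢
        simp only [Nat.sub_self, pow_zero, mul_one] at hcount
        rcases hcap with hcap | hcap
        · omega
        · omega
      · obtain ⟨j, v, hij, hj, hadj, hnew, hmin⟩ :=
          exists_extension hT (Nat.succ_pos _) hlt hi
        have hsame : ∀ m < t.length + 1, Function.update φ (t.length + 1) v m = φ m :=
          fun m hm => Function.update_of_ne hm.ne _ _
        refine ih (j :: t) j (Function.update φ (t.length + 1) v) (hall j ?_) ?_ ?_ ?_
        · rw [List.mem_range'_1]
          omega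
        · intro a ha b hb hab
          simp only [List.length_cons, coe_range, Set.mem_Iio] at ha hb
          rcases Nat.lt_succ_iff_lt_or_eq.1 ha with ha | rfl <;>
            rcases Nat.lt_succ_iff_lt_or_eq.1 hb with hb | rfl
          · rw [hsame a ha, hsame b hb] at hab
            exact hφ (by simpa using ha) (by simpa using hb) hab
          · rw [hsame a ha, Function.update_self] at hab
            exact absurd hab (hnew a ha)
          · rw [hsame b hb, Function.update_self] at hab
            exact absurd hab.symm (hnew b hb)
          · rfl
        · refine ⟨by omega, ?_, ht.congr fun a ha b hb hab => ?_⟩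
          · rw [SimpleGraph.comap_adj, Function.update_self, hsame j hj]
            exact hadj.symm
          · rw [SimpleGraph.comap_adj, hsame a (by omega), hsame b (by omega)]
            exact hab
        · intro j' hj' _ w hw
          rw [hsame j' (by omega)] at hw
          obtain ⟨m, hm, hmw⟩ := hmin j' hj' w hw
          exact ⟨m, by rw [List.length_cons]; omega, by rw [hsame m hm, hmw]⟩

/-! ### Trees that are not spiders -/

theorem SimpleGraph.IsAcyclic.not_adj_of_adj_adj {V : Type*} {T : SimpleGraph V}
    (hT : T.IsAcyclic) {a b c : V} (hab : T.Adj a b) (hbc : T.Adj b c) : ¬ T.Adj a c := by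
  intro hac
  have h := (hT.subsingleton_path a c).elim
    ⟨.cons hab (.cons hbc .nil), by simp [hab.ne, hac.ne, hbc.ne]⟩
    ⟨.cons hac .nil, by simp [hac.ne]⟩
  have := congrArg (fun p : T.Path a c => p.1.length) h
  simp at this

theorem SimpleGraph.IsAcyclic.eq_of_adj_of_adj {V : Type*} {T : SimpleGraph V}
    (hT : T.IsAcyclic) {a b c d : V} (hac : a ≠ c) (hab : T.Adj a b) (hbc : T.Adj b c)
    (had : T.Adj a d) (hdc : T.Adj d c) : b = d := by
  have h := (hT.subsingleton_path a c).elim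
    ⟨.cons hab (.cons hbc .nil), by simp [hab.ne, hac, hbc.ne]⟩
    ⟨.cons had (.cons hdc .nil), by simp [had.ne, hac, hdc.ne]⟩
  have := congrArg (fun p : T.Path a c => p.1.support) h
  simpa using this

/-- `T` has a (not necessarily induced) subgraph isomorphic to the tree with parent list `t`. -/
def HasSubtree {V : Type*} (T : SimpleGraph V) (t : List ℕ) : Prop :=
  ∃ φ : ℕ → V, Set.InjOn φ (range (t.length + 1)) ∧ ContainsTree (T.comap φ) t

theorem HasSubtree.of_list {V : Type*} {T : SimpleGraph V} {t : List ℕ} (a : V) (l : List V)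
    (hl : l.Nodup) (hlen : l.length = t.length + 1)
    (h : ContainsTree (T.comap fun i => l.getD i a) t) : HasSubtree T t := by
  refine ⟨_, ?_, h⟩
  intro i hi j hj hij
  simp only [coe_range, Set.mem_Iio, ← hlen] at hi hj
  simp only [List.getD_eq_getElem _ _ hi, List.getD_eq_getElem _ _ hj] at hij
  exact (hl.getElem_inj_iff).1 hij

/-- All components of `T - u` have order at most two. This is phrased for a tree `T`: a neighbour
of `u` has at most one neighbour besides `u`, and such a neighbour is a leaf. -/
def IsSpiderCentre {V : Type*} (T : SimpleGraph V) (u : V) : Prop :=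
  (∀ x y z, T.Adj u x → T.Adj x y → T.Adj x z → y ≠ u → z ≠ u → y = z) ∧
    ∀ x y z, T.Adj u x → T.Adj x y → y ≠ u → T.Adj y z → z = x

/-- A vertex of degree at least three is a spider centre, or one of the two trees of order `6`
is formed by it, two of its neighbours, and three vertices behind a third one. -/
theorem isSpiderCentre_or_hasSubtree {V : Type*} {T : SimpleGraph V} (hT : T.IsAcyclic)
    {u a b c : V} (ha : T.Adj u a) (hb : T.Adj u b) (hc : T.Adj u c) (hab : a ≠ b) (hac : a ≠ c)
    (hbc : b ≠ c) :
    IsSpiderCentre T u ∨ HasSubtree T [1, 1, 0, 0, 0] ∨ HasSubtree T [4, 3, 0, 0, 0] := by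
  have htwo : ∀ x, ∃ p q, T.Adj u p ∧ T.Adj u q ∧ p ≠ q ∧ p ≠ x ∧ q ≠ x := by
    intro x
    by_cases hax : a = x
    · exact ⟨b, c, hb, hc, hbc, hax ▸ hab.symm, hax ▸ hac.symm⟩
    · by_cases hbx : b = x
      · exact ⟨a, c, ha, hc, hac, hax, hbx ▸ hbc.symm⟩
      · exact ⟨a, b, ha, hb, hab, hax, hbx⟩
  by_contra! h
  obtain ⟨h0, h1, h2⟩ := h
  refine h0 ⟨fun x y z hx hy hz hyu hzu => ?_, fun x y z hx hy hyu hz => ?_⟩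
  · by_contra! hyz
    obtain ⟨p, q, hp, hq, hpq, hpx, hqx⟩ := htwo x
    have huy := hT.not_adj_of_adj_adj hx hy
    have huz := hT.not_adj_of_adj_adj hx hz
    refine h1 (.of_list u [u, x, p, q, y, z] ?_ rfl ?_)
    · have h3 : p ≠ y := fun h => huy (h ▸ hp)
      have h4 : p ≠ z := fun h => huz (h ▸ hp)
      have h5 : q ≠ y := fun h => huy (h ▸ hq)
      have h6 : q ≠ z := fun h => huz (h ▸ hq)
      simp [hx.ne, hp.ne, hq.ne, hyu.symm, hzu.symm, hpx.symm, hqx.symm, hy.ne, hz.ne, hpq, hyz,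
        h3, h4, h5, h6]
    · simp [ContainsTree, hy.symm, hz.symm, hx.symm, hp.symm, hq.symm]
  · by_contra! hzx
    obtain ⟨p, q, hp, hq, hpq, hpx, hqx⟩ := htwo x
    have huy := hT.not_adj_of_adj_adj hx hy
    have hzu : z ≠ u := by
      rintro rfl
      exact huy hz.symm
    have huz : ¬ T.Adj u z := fun h => hzx (hT.eq_of_adj_of_adj hyu.symm h hz.symm hx hy)
    refine h2 (.of_list u [u, p, q, x, y, z] ?_ rfl ?_)
    · have h3 : p ≠ y := fun h => huy (h ▸ hp)
      have h4 : p ≠ z := fun h => huz (h ▸ hp)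
      have h5 : q ≠ y := fun h => huy (h ▸ hq)
      have h6 : q ≠ z := fun h => huz (h ▸ hq)
      simp [hx.ne, hp.ne, hq.ne, hyu.symm, hzu.symm, hpx, hqx, hy.ne, hz.ne, hpq, hzx.symm,
        h3, h4, h5, h6]
    · simp [ContainsTree, hy.symm, hz.symm, hx.symm, hp.symm, hq.symm]

/-- In a connected graph without vertices of degree three, a path that does not contain all
vertices can be prolonged at one of its ends. -/
theorem exists_path {V : Type*} [Fintype V] {T : SimpleGraph V} (hT : T.Connected)
    (hdeg : ∀ u a b c, T.Adj u a → T.Adj u b → T.Adj u c → a = b ∨ a = c ∨ b = c) :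
    ∀ k, 0 < k → k ≤ Fintype.card V →
      ∃ φ : ℕ → V, Set.InjOn φ (range k) ∧ ∀ i, i + 1 < k → T.Adj (φ i) (φ (i + 1)) := by
  intro k hk
  induction k, hk using Nat.le_induction with
  | base =>
    intro _
    obtain ⟨a⟩ := hT.nonempty
    exact ⟨fun _ => a, by simp, by omega⟩
  | succ k hk ih =>
    intro hkV
    obtain ⟨φ, hinj, hadj⟩ := ih (by omega)
    obtain ⟨j, v, -, hjk, hv, hnew, -⟩ :=
      exists_extension hT hk (φ := φ) (by omega) (i := 0) (by simp)
    have hinj' : ∀ a < k, ∀ b < k, φ a = φ b → a = b := fun a ha b hb h =>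
      hinj (by simpa using ha) (by simpa using hb) h
    by_cases hjl : j + 1 = k
    · have hsame : ∀ m < k, Function.update φ k v m = φ m :=
        fun m hm => Function.update_of_ne hm.ne _ _
      refine ⟨Function.update φ k v, ?_, fun i hi => ?_⟩
      · intro a ha b hb hab
        simp only [coe_range, Set.mem_Iio] at ha hb
        rcases Nat.lt_succ_iff_lt_or_eq.1 ha with ha | rfl <;>
          rcases Nat.lt_succ_iff_lt_or_eq.1 hb with hb | rfl
        · rw [hsame a ha, hsame b hb] at hab
          exact hinj' a ha b hb hab
        · rw [hsame a ha, Function.update_self] at hab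
          exact absurd hab (hnew a ha)
        · rw [hsame b hb, Function.update_self] at hab
          exact absurd hab.symm (hnew b hb)
        · rfl
      · rcases Nat.lt_succ_iff_lt_or_eq.1 hi with hi | hi
        · rw [hsame i (by omega), hsame _ hi]
          exact hadj i hi
        · rw [hsame i (by omega), hi, Function.update_self, show i = j by omega]
          exact hv
    · obtain rfl | hj0 := Nat.eq_zero_or_pos j
      · refine ⟨fun i => Nat.casesOn i v φ, ?_, fun i hi => ?_⟩
        · intro a ha b hb hab
          simp only [coe_range, Set.mem_Iio] at ha hb
          rcases a with _ | a <;> rcases b with _ | b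
          · rfl
          · exact absurd hab.symm (hnew b (by omega))
          · exact absurd hab (hnew a (by omega))
          · rw [hinj' a (by omega) b (by omega) hab]
        · rcases i with _ | i
          · exact hv.symm
          · exact hadj i (by omega)
      · exfalso
        have h1 := hadj (j - 1) (by omega)
        rw [show j - 1 + 1 = j by omega] at h1
        have h2 := hadj j (by omega)
        rcases hdeg _ _ _ _ h1.symm h2 hv with h | h | h
        · have := hinj' _ (by omega) _ (by omega) h
          omega
        · exact hnew _ (by omega) h
        · exact hnew _ (by omega) h

theorem exists_isSpiderCentre_or_hasSubtree {V : Type*} [Fintype V] {T : SimpleGraph V}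
    (hT : T.IsTree) (hV : 6 ≤ Fintype.card V) :
    (∃ u, IsSpiderCentre T u) ∨ HasSubtree T [4, 3, 2, 1, 0] ∨ HasSubtree T [1, 1, 0, 0, 0] ∨
      HasSubtree T [4, 3, 0, 0, 0] := by
  by_cases hdeg : ∀ u a b c, T.Adj u a → T.Adj u b → T.Adj u c → a = b ∨ a = c ∨ b = c
  · obtain ⟨φ, hφ, hadj⟩ := exists_path hT.connected hdeg 6 (by omega) hV
    refine Or.inr (Or.inl ⟨φ, hφ, ?_⟩)
    simp only [ContainsTree, SimpleGraph.comap_adj, List.length_cons, List.length_nil]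
    refine ⟨by omega, (hadj 4 (by omega)).symm, by omega, (hadj 3 (by omega)).symm, by omega,
      (hadj 2 (by omega)).symm, by omega, (hadj 1 (by omega)).symm, by omega,
      (hadj 0 (by omega)).symm, trivial⟩
  · push Not at hdeg
    obtain ⟨u, a, b, c, ha, hb, hc, hab, hac, hbc⟩ := hdeg
    rcases isSpiderCentre_or_hasSubtree hT.isAcyclic ha hb hc hab hac hbc with h | h
    · exact Or.inl ⟨u, h⟩
    · exact Or.inr (Or.inr h)

theorem numDissociationSets_lt_of_forall_not_isSpiderCentre {V : Type*} [Fintype V]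
    {T : SimpleGraph V} (hT : T.IsTree) (hV : 9 ≤ Fintype.card V)
    (hspider : ∀ u, ¬ IsSpiderCentre T u) : numDissociationSets T < hBound (Fintype.card V) := by
  have key : numDissociationSets T ≤ 2 ^ (Fintype.card V - 1) ∨
      numDissociationSets T < orderCap (Fintype.card V) := by
    rcases exists_isSpiderCentre_or_hasSubtree hT (by omega) with
      ⟨u, hu⟩ | ⟨φ, hφ, ht⟩ | ⟨φ, hφ, ht⟩ | ⟨φ, hφ, ht⟩
    · exact absurd hu (hspider u)
    · exact numDissociationSets_of_growthSearch hT.connected hV _ _ 0 φ growthSearch_path hφ ht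
        (by simp)
    · exact numDissociationSets_of_growthSearch hT.connected hV _ _ 0 φ growthSearch_doubleStar
        hφ ht (by simp)
    · exact numDissociationSets_of_growthSearch hT.connected hV _ _ 0 φ growthSearch_fork hφ ht
        (by simp)
  have hpow : 2 ^ (Fintype.card V - 1) < hBound (Fintype.card V) := by
    unfold hBound
    split_ifs
    · have : 0 < 2 ^ ((Fintype.card V - 7) / 2) := by positivity
      have : 0 < (Fintype.card V + 9) * 2 ^ ((Fintype.card V - 7) / 2) := by positivity
      omega
    · omega
    · have : 0 < (Fintype.card V + 12) * 2 ^ ((Fintype.card V - 8) / 2) := by positivity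
      omega
  have hcap : orderCap (Fintype.card V) ≤ hBound (Fintype.card V) := by
    generalize Fintype.card V = n at *
    obtain rfl | rfl | hn : n = 9 ∨ n = 10 ∨ 11 ≤ n := by omega
    · decide
    · decide
    · have : 2 ^ 10 ≤ 2 ^ (n - 1) := Nat.pow_le_pow_right (by omega) (by omega)
      rw [orderCap, if_neg (by omega)]
      omega
  omega

/-! ### Spiders with legs of length at most two -/

/-- Adjacency of `legSpider`. -/
def legAdj {α β : Type*} : Option (α ⊕ β × Bool) → Option (α ⊕ β × Bool) → Prop
  | none, some (.inl _) => True
  | some (.inl _), none => True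
  | none, some (.inr (_, s)) => s = false
  | some (.inr (_, s)), none => s = false
  | some (.inr (x, s)), some (.inr (y, s')) => x = y ∧ s ≠ s'
  | _, _ => False

/-- The spider whose centre `none` has a leg of length one for each element of `α` and a leg of
length two for each element `x` of `β`; the vertices of the latter are `(x, false)`, next to
the centre, and the leaf `(x, true)`. -/
def legSpider (α β : Type*) : SimpleGraph (Option (α ⊕ β × Bool)) where
  Adj := legAdj
  symm := ⟨by
    rintro (_ | x | ⟨x, s⟩) (_ | y | ⟨y, s'⟩) h
    all_goals first | exact h | exact ⟨h.1.symm, h.2.symm⟩⟩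
  loopless := ⟨by
    rintro (_ | x | ⟨x, s⟩) h
    · exact h
    · exact h
    · exact h.2 rfl⟩

/-- An isomorphism from a bijection that preserves and reflects adjacency. -/
theorem SimpleGraph.nonempty_iso_of_bijective {V W : Type*} {G : SimpleGraph V} {H : SimpleGraph W}
    (f : V → W) (hf : Function.Bijective f) (h : ∀ x y, H.Adj (f x) (f y) ↔ G.Adj x y) :
    Nonempty (G ≃g H) :=
  ⟨⟨Equiv.ofBijective f hf, fun {a b} => h a b⟩⟩

theorem legSpider_congr {α α' β β' : Type*} (e : α ≃ α') (f : β ≃ β') :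
    Nonempty (legSpider α β ≃g legSpider α' β') := by
  refine SimpleGraph.nonempty_iso_of_bijective
    (Equiv.optionCongr (Equiv.sumCongr e (Equiv.prodCongr f (Equiv.refl Bool))))
    (Equiv.bijective _) ?_
  rintro (_ | x | ⟨x, s⟩) (_ | y | ⟨y, s'⟩) <;> simp [legSpider, legAdj]

theorem sigma_fin_eq_iff {ι : Type*} {s : ι → ℕ} (x y : Σ i, Fin (s i)) :
    x = y ↔ x.1 = y.1 ∧ x.2.val = y.2.val := by
  constructor
  · rintro rfl
    exact ⟨rfl, rfl⟩
  · obtain ⟨i, p⟩ := x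
    obtain ⟨j, q⟩ := y
    rintro ⟨h, hpq⟩
    dsimp only at h
    subst h
    exact congrArg _ (Fin.ext hpq)

theorem legSpider_iso_starK_one (a b : ℕ) :
    Nonempty (legSpider (Fin a) (Fin b) ≃g starK 1 a b) := by
  refine SimpleGraph.nonempty_iso_of_bijective (fun v => match v with
    | none => .inl 0
    | some (.inl x) => .inr ⟨.inl x, ⟨0, Nat.one_pos⟩⟩
    | some (.inr (x, s)) => .inr ⟨.inr x, ⟨s.toNat, s.toNat_lt⟩⟩) ⟨?_, ?_⟩ ?_
  · rintro (_ | x | ⟨x, _ | _⟩) (_ | y | ⟨y, _ | _⟩) h <;>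
      simp_all [-Sigma.mk.injEq, sigma_fin_eq_iff]
  · rintro (x | ⟨x | x, i⟩)
    · exact ⟨none, congrArg _ (Subsingleton.elim (α := Fin 1) _ _)⟩
    · exact ⟨some (.inl x), by
        have : i.val = 0 := Nat.lt_one_iff.1 i.2
        simp [-Sigma.mk.injEq, sigma_fin_eq_iff, this]⟩
    · change Fin 2 at i
      fin_cases i
      · exact ⟨some (.inr (x, false)), rfl⟩
      · exact ⟨some (.inr (x, true)), rfl⟩
  · rintro (_ | x | ⟨x, _ | _⟩) (_ | y | ⟨y, _ | _⟩) <;>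
      simp [legSpider, legAdj, starK, starGraphOf, starAdj, -Sigma.mk.injEq, sigma_fin_eq_iff]

theorem legSpider_iso_starK_two (b : ℕ) :
    Nonempty (legSpider (Fin 1) (Fin b) ≃g starK 2 0 b) := by
  refine SimpleGraph.nonempty_iso_of_bijective (fun v => match v with
    | none => .inl 0
    | some (.inl x) => .inl 1
    | some (.inr (x, s)) => .inr ⟨.inr x, ⟨s.toNat, s.toNat_lt⟩⟩) ⟨?_, ?_⟩ ?_
  · rintro (_ | x | ⟨x, _ | _⟩) (_ | y | ⟨y, _ | _⟩) h <;>
      simp_all [-Sigma.mk.injEq, sigma_fin_eq_iff]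
    exact Subsingleton.elim _ _
  · rintro (x | ⟨x | x, i⟩)
    · fin_cases x
      · exact ⟨none, rfl⟩
      · exact ⟨some (.inl 0), rfl⟩
    · exact x.elim0
    · change Fin 2 at i
      fin_cases i
      · exact ⟨some (.inr (x, false)), rfl⟩
      · exact ⟨some (.inr (x, true)), rfl⟩
  · rintro (_ | x | ⟨x, _ | _⟩) (_ | y | ⟨y, _ | _⟩) <;>
      simp [legSpider, legAdj, starK, starGraphOf, starAdj, -Sigma.mk.injEq, sigma_fin_eq_iff]

theorem IsSpiderCentre.exists_iso_legSpider {V : Type*} [Fintype V] {T : SimpleGraph V}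
    (hT : T.IsTree) {u : V} (hu : IsSpiderCentre T u) :
    ∃ a b, Fintype.card V = 1 + a + 2 * b ∧ Nonempty (legSpider (Fin a) (Fin b) ≃g T) := by
  classical
  let α := {x // T.Adj u x ∧ ∀ y, T.Adj x y → y = u}
  let β := {x // T.Adj u x ∧ ∃ y, T.Adj x y ∧ y ≠ u}
  choose g hg hgu using fun x : β => x.2.2
  obtain ⟨hu1, hu2⟩ := hu
  have hac := hT.isAcyclic
  have hug : ∀ x, ¬ T.Adj u (g x) := fun x => hac.not_adj_of_adj_adj x.2.1 (hg x)
  have hNN : ∀ x y, T.Adj u x → T.Adj u y → ¬ T.Adj x y := fun x y hx hy hxy =>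
    hac.not_adj_of_adj_adj hx hxy hy
  have hgx : ∀ x z, T.Adj (g x) z → z = x := fun x z hz => hu2 x (g x) z x.2.1 (hg x) (hgu x) hz
  obtain ⟨φ⟩ : Nonempty (legSpider α β ≃g T) := by
    refine SimpleGraph.nonempty_iso_of_bijective (fun v => match v with
      | none => u
      | some (.inl x) => x.1
      | some (.inr (x, false)) => x.1
      | some (.inr (x, true)) => g x) ⟨?_, ?_⟩ ?_
    · rintro (_ | x | ⟨x, _ | _⟩) (_ | y | ⟨y, _ | _⟩) h <;> dsimp only at h
      · rfl
      · exact absurd h y.2.1.ne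
      · exact absurd h y.2.1.ne
      · exact absurd h.symm (hgu y)
      · exact absurd h.symm x.2.1.ne
      · rw [Subtype.ext h]
      · obtain ⟨z, hz, hzu⟩ := y.2.2
        exact absurd (x.2.2 z (h ▸ hz)) hzu
      · exact absurd (h ▸ x.2.1) (hug y)
      · exact absurd h.symm x.2.1.ne
      · obtain ⟨z, hz, hzu⟩ := x.2.2
        exact absurd (y.2.2 z (h ▸ hz)) hzu
      · rw [Subtype.ext h]
      · exact absurd (h ▸ x.2.1) (hug y)
      · exact absurd h (hgu x)
      · exact absurd (h ▸ y.2.1) (hug x)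
      · exact absurd (h ▸ y.2.1) (hug x)
      · rw [Subtype.ext (hgx y x (h ▸ (hg x).symm))]
    · intro w
      by_contra! hw
      have hwS : w ∉ {x | x = u ∨ T.Adj u x ∨ ∃ y, x = g y} := by
        rintro (h | h | ⟨y, h⟩)
        · exact hw none h.symm
        · by_cases hleaf : ∀ y, T.Adj w y → y = u
          · exact hw (some (.inl ⟨w, h, hleaf⟩)) rfl
          · push Not at hleaf
            exact hw (some (.inr (⟨w, h, hleaf⟩, false))) rfl
        · exact hw (some (.inr (y, true))) h.symm
      obtain ⟨p⟩ := hT.connected.preconnected u w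
      obtain ⟨d, -, hd1, hd2⟩ := p.exists_boundary_dart
        {x | x = u ∨ T.Adj u x ∨ ∃ y, x = g y} (Or.inl rfl) hwS
      refine hd2 ?_
      have hd := d.adj
      rcases hd1 with h | h | ⟨y, h⟩
      · exact Or.inr (Or.inl (h ▸ hd))
      · by_cases hdu : d.snd = u
        · exact Or.inl hdu
        · let y : β := ⟨d.fst, h, d.snd, hd, hdu⟩
          exact Or.inr (Or.inr ⟨y, hu1 _ _ _ h hd (hg y) hdu (hgu y)⟩)
      · rw [h] at hd
        exact Or.inr (Or.inl (hgx y _ hd ▸ y.2.1))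
    · rintro (_ | x | ⟨x, _ | _⟩) (_ | y | ⟨y, _ | _⟩) <;>
        simp only [legSpider, legAdj, iff_true, iff_false, SimpleGraph.irrefl, not_false_eq_true,
          ne_eq, not_true_eq_false, and_false, and_true, reduceCtorEq]
      · exact y.2.1
      · exact y.2.1
      · exact hug y
      · exact x.2.1.symm
      · exact hNN _ _ x.2.1 y.2.1
      · exact hNN _ _ x.2.1 y.2.1
      · exact fun h => hgu y (x.2.2 _ h)
      · exact x.2.1.symm
      · exact hNN _ _ x.2.1 y.2.1
      · exact hNN _ _ x.2.1 y.2.1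
      · exact ⟨fun h => Subtype.ext (hgx y _ h.symm), fun h => h ▸ hg x⟩
      · exact fun h => hug x h.symm
      · exact fun h => hgu x (y.2.2 _ h.symm)
      · exact ⟨fun h => (Subtype.ext (hgx x _ h)).symm, fun h => h ▸ (hg x).symm⟩
      · exact fun h => hug y (hgx x _ h ▸ x.2.1)
  obtain ⟨ψ⟩ := legSpider_congr (Fintype.equivFin α) (Fintype.equivFin β)
  refine ⟨Fintype.card α, Fintype.card β, ?_, ⟨ψ.symm.trans φ⟩⟩
  rw [← Fintype.card_congr φ.toEquiv]
  simp only [Fintype.card_option, Fintype.card_sum, Fintype.card_prod, Fintype.card_bool]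
  ring

/-- The neighbours of the centre of `legSpider α β`. -/
def legFoot {α β : Type*} : α ⊕ β → Option (α ⊕ β × Bool)
  | .inl x => some (.inl x)
  | .inr x => some (.inr (x, false))

open Classical in
/-- The vertex set containing the centre, its neighbour `o` (or none of them), and the leaves of
the legs of length two given by `D`. -/
noncomputable def legSet {α β : Type*} [Fintype α] [Fintype β] (o : Option (α ⊕ β))
    (D : Finset β) : Finset (Option (α ⊕ β × Bool)) :=
  univ.filter fun v => match v with
    | none => True
    | some (.inl x) => o = some (.inl x)
    | some (.inr (x, false)) => o = some (.inr x)
    | some (.inr (x, true)) => x ∈ D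

/-! ### Counting the dissociation sets of a spider -/

@[simp] theorem none_mem_legSet {α β : Type*} [Fintype α] [Fintype β] (o : Option (α ⊕ β))
    (D : Finset β) : none ∈ legSet o D := by simp [legSet]

@[simp] theorem legFoot_mem_legSet {α β : Type*} [Fintype α] [Fintype β] (o : Option (α ⊕ β))
    (D : Finset β) (m : α ⊕ β) : legFoot m ∈ legSet o D ↔ o = some m := by
  rcases m with x | x <;> simp [legSet, legFoot]

@[simp] theorem leaf_mem_legSet {α β : Type*} [Fintype α] [Fintype β] (o : Option (α ⊕ β))
    (D : Finset β) (x : β) : some (.inr (x, true)) ∈ legSet o D ↔ x ∈ D := by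
  simp [legSet]

theorem legSpider_adj_cases {α β : Type*} {v w : Option (α ⊕ β × Bool)}
    (h : (legSpider α β).Adj v w) :
    (v = none ∧ ∃ m, w = legFoot m) ∨ (w = none ∧ ∃ m, v = legFoot m) ∨
      (∃ x, v = legFoot (.inr x) ∧ w = some (.inr (x, true))) ∨
      ∃ x, w = legFoot (.inr x) ∧ v = some (.inr (x, true)) := by
  rcases v with _ | x | ⟨x, _ | _⟩ <;> rcases w with _ | y | ⟨y, _ | _⟩ <;>
    simp_all [legSpider, legAdj, legFoot]

theorem legSpider_adj_none_legFoot {α β : Type*} (m : α ⊕ β) :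
    (legSpider α β).Adj none (legFoot m) := by
  rcases m with x | x <;> simp [legSpider, legAdj, legFoot]

theorem legFoot_injective {α β : Type*} : Function.Injective (legFoot : α ⊕ β → _) := by
  rintro (x | x) (y | y) h <;> simp_all [legFoot]

theorem eq_legSet_iff {α β : Type*} [Fintype α] [Fintype β] {o : Option (α ⊕ β)}
    {D : Finset β} {S : Finset (Option (α ⊕ β × Bool))} :
    S = legSet o D ↔ none ∈ S ∧ (∀ m, legFoot m ∈ S ↔ o = some m) ∧
      ∀ x, some (.inr (x, true)) ∈ S ↔ x ∈ D := by
  constructor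
  · rintro rfl
    simp
  · rintro ⟨h1, h2, h3⟩
    ext v
    rcases v with _ | x | ⟨x, _ | _⟩
    · simp [h1]
    · exact (h2 (.inl x)).trans (legFoot_mem_legSet o D (.inl x)).symm
    · exact (h2 (.inr x)).trans (legFoot_mem_legSet o D (.inr x)).symm
    · exact (h3 x).trans (leaf_mem_legSet o D x).symm

open Classical in
/-- The legs of length two whose leaf may be chosen together with the centre and its
neighbour `o`. -/
noncomputable def freeLegs {α β : Type*} [Fintype β] : Option (α ⊕ β) → Finset β
  | some (.inr x) => univ.erase x
  | _ => univ

theorem dissociated_legSet {α β : Type*} [Fintype α] [Fintype β] {o : Option (α ⊕ β)}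
    {D : Finset β} (hD : D ⊆ freeLegs o) : Dissociated (legSpider α β) (legSet o D) := by
  have hfree : ∀ x, o = some (.inr x) → x ∉ D := by
    rintro x rfl hx
    simpa [freeLegs] using hD hx
  -- A neighbour of the centre and a leaf each have at most one chosen neighbour, and so has
  -- the centre, because it has only one chosen neighbour `o`.
  intro v hv a ha b hb hva hvb
  rcases legSpider_adj_cases hva with ⟨rfl, m, rfl⟩ | ⟨rfl, m, rfl⟩ | ⟨x, rfl, rfl⟩ |
      ⟨x, rfl, rfl⟩
  · rcases legSpider_adj_cases hvb with ⟨-, m', rfl⟩ | ⟨rfl, m', h⟩ | ⟨x', h, rfl⟩ |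
      ⟨x', rfl, h⟩
    · rw [legFoot_mem_legSet] at ha hb
      rw [Option.some_injective _ (ha.symm.trans hb)]
    · rcases m' with _ | _ <;> simp [legFoot] at h
    · simp [legFoot] at h
    · simp at h
  · rcases legSpider_adj_cases hvb with ⟨h, m', rfl⟩ | ⟨rfl, m', h⟩ | ⟨x', h, rfl⟩ |
      ⟨x', rfl, h⟩
    · rcases m with _ | _ <;> simp [legFoot] at h
    · rfl
    · rw [legFoot_injective h, legFoot_mem_legSet] at hv
      exact absurd ((leaf_mem_legSet _ _ _).1 hb) (hfree _ hv)
    · rcases m with _ | _ <;> simp [legFoot] at h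
  · exact absurd ((leaf_mem_legSet _ _ _).1 ha) (hfree _ ((legFoot_mem_legSet _ _ _).1 hv))
  · rw [legFoot_mem_legSet] at ha
    exact absurd ((leaf_mem_legSet _ _ _).1 hv) (hfree _ ha)

theorem exists_eq_legSet {α β : Type*} [Fintype α] [Fintype β]
    {S : Finset (Option (α ⊕ β × Bool))} (hS : Dissociated (legSpider α β) S) (h0 : none ∈ S) :
    ∃ o, ∃ D ⊆ freeLegs o, S = legSet o D := by
  classical
  have hleaf : ∀ x : β, legFoot (.inr x) ∈ S → some (.inr (x, true)) ∉ S := by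
    intro x hx hx'
    have := hS _ hx _ h0 _ hx' (legSpider_adj_none_legFoot _).symm
      (by simp [legSpider, legAdj, legFoot])
    simp at this
  by_cases h : ∃ m, legFoot m ∈ S
  · obtain ⟨m, hm⟩ := h
    refine ⟨some m, univ.filter (fun x => some (.inr (x, true)) ∈ S), ?_, ?_⟩
    · rcases m with x | x
      · exact subset_univ _
      · intro y hy
        rw [freeLegs, mem_erase]
        refine ⟨?_, mem_univ _⟩
        rintro rfl
        exact hleaf y hm (by simpa using hy)
    · refine eq_legSet_iff.2 ⟨h0, fun m' => ⟨fun hm' => ?_, ?_⟩, by simp⟩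
      · rw [legFoot_injective (hS _ h0 _ hm _ hm' (legSpider_adj_none_legFoot _)
          (legSpider_adj_none_legFoot _))]
      · intro h
        rwa [← Option.some_injective _ h]
  · push Not at h
    exact ⟨none, univ.filter (fun x => some (.inr (x, true)) ∈ S), subset_univ _,
      eq_legSet_iff.2 ⟨h0, by simpa using h, by simp⟩⟩

theorem two_mul_numDissociationSets_legSpider {α β : Type*} [Fintype α] [Fintype β] :
    2 * numDissociationSets (legSpider α β) =
      2 ^ (1 + Fintype.card α + 2 * Fintype.card β) +
        2 ^ Fintype.card β * (2 + 2 * Fintype.card α + Fintype.card β) := by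
  classical
  rw [numDissociationSets_eq, dissociatedCount,
    ← card_filter_add_card_filter_not (fun S => none ∈ S), filter_filter, filter_filter]
  have hout : ({S ∈ (univ : Finset (Option (α ⊕ β × Bool))).powerset |
      Dissociated (legSpider α β) S ∧ none ∉ S}) = (univ.erase none).powerset := by
    ext S
    simp only [mem_filter, mem_powerset, subset_univ, true_and, subset_erase]
    refine ⟨fun h => h.2, fun h => ⟨?_, h⟩⟩
    intro v hv a ha b hb hva hvb
    rcases v with _ | x | ⟨x, _ | _⟩ <;> rcases a with _ | y | ⟨y, _ | _⟩ <;>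
      rcases b with _ | z | ⟨z, _ | _⟩ <;> simp_all [legSpider, legAdj]
  have hin : #{S ∈ (univ : Finset (Option (α ⊕ β × Bool))).powerset |
      Dissociated (legSpider α β) S ∧ none ∈ S} =
      #((univ : Finset (Option (α ⊕ β))).sigma fun o => (freeLegs o).powerset) := by
    symm
    refine card_bij (fun p _ => legSet p.1 p.2) ?_ ?_ ?_
    · rintro ⟨o, D⟩ h
      simp only [mem_sigma, mem_univ, true_and, mem_powerset] at h
      simpa using dissociated_legSet h
    · rintro ⟨o, D⟩ - ⟨o', D'⟩ - h
      obtain ⟨-, h1, h2⟩ := eq_legSet_iff.1 h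
      simp only [legFoot_mem_legSet, leaf_mem_legSet] at h1 h2
      obtain rfl : o = o' := Option.ext h1
      obtain rfl : D = D' := Finset.ext h2
      rfl
    · intro S hS
      simp only [mem_filter, mem_powerset, subset_univ, true_and] at hS
      obtain ⟨o, D, hD, rfl⟩ := exists_eq_legSet hS.1 hS.2
      exact ⟨⟨o, D⟩, by simpa using hD, rfl⟩
  have hout' : #((univ : Finset (Option (α ⊕ β × Bool))).erase none).powerset =
      2 ^ (Fintype.card α + 2 * Fintype.card β) := by
    rw [card_powerset, card_erase_of_mem (mem_univ _), card_univ]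
    simp only [Fintype.card_option, Fintype.card_sum, Fintype.card_prod, Fintype.card_bool,
      Nat.add_sub_cancel]
    ring_nf
  have hin' : 2 * #((univ : Finset (Option (α ⊕ β))).sigma fun o => (freeLegs o).powerset) =
      2 ^ Fintype.card β * (2 + 2 * Fintype.card α + Fintype.card β) := by
    have hb : ∀ _x : β, 2 * 2 ^ (Fintype.card β - 1) = 2 ^ Fintype.card β := fun x => by
      have : 0 < Fintype.card β := Fintype.card_pos_iff.2 ⟨x⟩
      rw [← pow_succ', Nat.sub_add_cancel this]
    rw [card_sigma, Fintype.sum_option, Fintype.sum_sum_type]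
    simp only [card_powerset, freeLegs, card_erase_of_mem (mem_univ _), card_univ]
    rw [mul_add, mul_add, mul_sum, mul_sum, sum_congr rfl fun x _ => hb x]
    simp only [sum_const, card_univ, smul_eq_mul]
    ring
  rw [hout, hin, hout', mul_add, hin']
  ring

/-! ### The largest and the second largest number -/

theorem theorem3p2 {V : Type*} [Fintype V] (n : ℕ) (hn : 9 ≤ n) (hV : Fintype.card V = n)
    (T : SimpleGraph V) (hT : T.IsTree) (hF : ¬ IsoF n T) :
    numDissociationSets T ≤ hBound n ∧ (numDissociationSets T = hBound n ↔ IsoT n T) := by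
  have hcount : ∀ a b, Nonempty (legSpider (Fin a) (Fin b) ≃g T) →
      2 * numDissociationSets T = 2 ^ (1 + a + 2 * b) + 2 ^ b * (2 + 2 * a + b) := by
    rintro a b ⟨e⟩
    rw [← numDissociationSets_congr e, two_mul_numDissociationSets_legSpider, Fintype.card_fin,
      Fintype.card_fin]
  have hiff : ∀ a b,
      Nonempty (T ≃g starK 1 a b) ↔ Nonempty (legSpider (Fin a) (Fin b) ≃g T) := by
    intro a b
    obtain ⟨e⟩ := legSpider_iso_starK_one a b
    exact ⟨fun ⟨f⟩ => ⟨e.trans f.symm⟩, fun ⟨f⟩ => ⟨f.symm.trans e⟩⟩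
  -- The number of legs of length one in the extremal spider `T_n`.
  obtain ⟨c, hc⟩ : ∃ c, c = if Odd n then 2 else 3 := ⟨_, rfl⟩
  have hIsoT : IsoT n T ↔ Nonempty (legSpider (Fin c) (Fin ((n - 1 - c) / 2)) ≃g T) := by
    rw [IsoT]
    split_ifs at hc ⊢ <;> subst hc
    · rw [hiff, show n - 1 - 2 = n - 3 by omega]
    · rw [hiff, show n - 1 - 3 = n - 4 by omega]
  have hbound : 2 * hBound n = 2 ^ n +
      2 ^ ((n - 1 - c) / 2) * (2 + 2 * c + (n - 1 - c) / 2) := by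
    by_cases hodd : Odd n
    · obtain ⟨k, hk⟩ := hodd
      obtain ⟨j, rfl⟩ : ∃ j, k = j + 4 := ⟨k - 4, by omega⟩
      have hodd : Odd n := ⟨_, hk⟩
      rw [hBound, if_pos hodd, hc, if_pos hodd, hk,
        show (2 * (j + 4) + 1 - 1 - 2) / 2 = j + 3 by omega,
        show (2 * (j + 4) + 1 - 7) / 2 = j + 1 by omega, Nat.add_sub_cancel]
      ring
    · obtain ⟨k, hk⟩ := Nat.not_odd_iff_even.1 hodd
      obtain ⟨j, rfl⟩ : ∃ j, k = j + 4 := ⟨k - 4, by omega⟩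
      rw [hBound, if_neg hodd, if_neg (by omega), hc, if_neg hodd, hk,
        show (j + 4 + (j + 4) - 1 - 3) / 2 = j + 2 by omega,
        show (j + 4 + (j + 4) - 8) / 2 = j by omega,
        show j + 4 + (j + 4) - 1 = 2 * j + 7 by omega]
      ring
  have hT_eq : IsoT n T → numDissociationSets T = hBound n := by
    intro h
    have h1 := hcount _ _ (hIsoT.1 h)
    have h2 : 1 + c + 2 * ((n - 1 - c) / 2) = n := by
      rw [hc]
      split_ifs with hodd
      · obtain ⟨k, hk⟩ := hodd
        omega
      · obtain ⟨k, hk⟩ := Nat.not_odd_iff_even.1 hodd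
        omega
    rw [h2] at h1
    omega
  by_cases hspider : ∃ u, IsSpiderCentre T u
  swap
  · push Not at hspider
    have hlt := numDissociationSets_lt_of_forall_not_isSpiderCentre hT (hV ▸ hn) hspider
    rw [hV] at hlt
    exact ⟨hlt.le, fun h => absurd h hlt.ne, hT_eq⟩
  obtain ⟨u, hu⟩ := hspider
  obtain ⟨a, b, hab, hiso⟩ := hu.exists_iso_legSpider hT
  rw [hV] at hab
  have hca : c ≤ a := by
    by_contra! hlt
    apply hF
    unfold IsoF
    split_ifs at hc ⊢ with hodd h6
    · obtain ⟨k, hk⟩ := hodd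
      rw [hiff]
      obtain rfl : a = 0 := by omega
      rwa [show (n - 1) / 2 = b by omega]
    · omega
    · obtain ⟨k, hk⟩ := Nat.not_odd_iff_even.1 hodd
      obtain rfl : a = 1 := by omega
      obtain ⟨e⟩ := legSpider_iso_starK_two b
      obtain ⟨f⟩ := hiso
      rw [show (n - 2) / 2 = b by omega]
      exact ⟨f.symm.trans e⟩
  -- By parity `a - c` is even.
  obtain ⟨d, rfl⟩ : ∃ d, a = c + 2 * d := by
    refine ⟨(a - c) / 2, ?_⟩
    split_ifs at hc with hodd
    · obtain ⟨k, hk⟩ := hodd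
      omega
    · obtain ⟨k, hk⟩ := Nat.not_odd_iff_even.1 hodd
      omega
  rw [show (n - 1 - c) / 2 = b + d by omega] at hbound hIsoT
  have h1 := hcount _ _ hiso
  rw [← hab] at h1
  obtain rfl | hd := Nat.eq_zero_or_pos d
  · have hTn : IsoT n T := hIsoT.2 (by simpa using hiso)
    exact ⟨(hT_eq hTn).le, fun _ => hTn, hT_eq⟩
  · have hlt : 2 ^ b * (2 + 2 * (c + 2 * d) + b) < 2 ^ (b + d) * (2 + 2 * c + (b + d)) := by
      have hc2 : 2 ≤ c := by
        rw [hc]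
        split_ifs <;> omega
      have hpow : d + 1 ≤ 2 ^ d := Nat.lt_two_pow_self
      rw [pow_add, mul_assoc]
      refine Nat.mul_lt_mul_of_pos_left ?_ (by positivity)
      calc _ < (d + 1) * (2 + 2 * c + (b + d)) := by nlinarith
        _ ≤ _ := by gcongr
    have hlt' : numDissociationSets T < hBound n := by omega
    exact ⟨hlt'.le, fun h => absurd h hlt'.ne, hT_eq⟩
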